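/- **Theorem 1.4.** Let $\alpha=\{A_n:n\ge 1\}$ be a countably infinite partition of $(0,1]$ into non-empty left-open, right-closed intervals, ordered from right to left starting from $A_1$; let $a_n$ be the length of $A_n$ and $t_n=\sum_{k\ge n}a_k$. Assume that $a_{n+1}<a_n$ for all sufficiently large $n$, and that there are $\theta>0$ and a slowly varying function $\psi$ with $t_n=\psi(n)\,n^{-\theta}$ for all $n\ge 1$. (A measurable function $\psi:(0,\infty)\to(0,\infty)$ is slowly varying if $\lim_{x\to\infty}\psi(xy)/\psi(x)=1$ for every $y>0$.) Let $L_\alpha:[0,1]\to[0,1]$ be given by $L_\alpha(0)=0$ and $L_\alpha(x)=(t_n-x)/a_n$ for $x\in A_n$. A point $x\in[0,1]$ has an infinite $\alpha$-Lüroth expansion if $L_\alpha^{k}(x)\neq0$ for all $k\ge0$; its digits $\ell_n(x)\ge1$, $n\ge1$, are then determined by $L_\alpha^{n-1}(x)\in A_{\ell_n(x)}$. Let $(s_n)_{n\ge1}$ be a sequence of positive integers with $s_n\to\infty$, let $N>3$ be a real number, and let $J$ be the set of all $x\in[0,1]$ that have an infinite $\alpha$-Lüroth expansion with $s_n\le\ell_n(x)<N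 s_n$ for all $n\ge1$. Then $$\dim_H J=\sigma,\qquad \sigma:=\liminf_{n\to\infty}\frac{\log(s_1\cdots s_n)}{(1+\theta)\log(s_1\cdots s_n)+\theta\log s_{n+1}} .$$ -/

import Mathlib

open Filter Topology MeasureTheory

noncomputable section

/-- A countable partition `{A_n : n ≥ 1}` of the unit interval (up to the point `0`) into nonempty
left-open, right-closed intervals, ordered from right to left starting from `A_1`.  It is given by
the lengths `a n` of its atoms, `n ≥ 1` (the value `a 0` has no meaning); the atoms are then
`A_n = (t_{n+1}, t_n]`, where `t_n` is the `n`-th tail. -/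
structure LurothPartition where
  /-- the Lebesgue measure of the `n`-th atom, `n ≥ 1` -/
  a : ℕ → ℝ
  a_pos : ∀ n, 1 ≤ n → 0 < a n
  hasSum_a : HasSum (fun k : ℕ => a (k + 1)) 1

namespace LurothPartition

variable (α : LurothPartition)

/-- The `n`-th tail `t_n = ∑_{k ≥ n} a_k`. -/
def t (n : ℕ) : ℝ := ∑' k : ℕ, α.a (n + k)

/-- The `n`-th atom `A_n`, `n ≥ 1`. -/
def atom (n : ℕ) : Set ℝ := Set.Ioc (α.t (n + 1)) (α.t n)

/-- The index `n ≥ 1` of the atom that contains `x`; it is `0` if `x` lies in no atom. -/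
def digit (x : ℝ) : ℕ := sInf {n : ℕ | 1 ≤ n ∧ x ∈ α.atom n}

/-- The `α`-Lüroth map: `x ↦ (t_n - x) / a_n` on `A_n`, and `0 ↦ 0`. -/
def map (x : ℝ) : ℝ :=
  if α.digit x = 0 then 0 else (α.t (α.digit x) - x) / α.a (α.digit x)

/-- The digit `ℓ_n(x)`, `n ≥ 1`, of the `α`-Lüroth expansion of `x`, that is, the index of the atom
that contains `L_α^{n-1}(x)`. -/
def ell (n : ℕ) (x : ℝ) : ℕ := α.digit (α.map^[n - 1] x)

/-- The expansion of `x ∈ [0,1]` is infinite: the orbit of `x` under the `α`-Lüroth map never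
hits `0`. -/
def HasInfiniteExpansion (x : ℝ) : Prop :=
  x ∈ Set.Icc (0 : ℝ) 1 ∧ ∀ k : ℕ, α.map^[k] x ≠ 0

end LurothPartition

/-- Slowly varying functions `ℝ⁺ → ℝ⁺` (values outside of `ℝ⁺` are irrelevant). -/
def IsSlowlyVarying (f : ℝ → ℝ) : Prop :=
  Measurable f ∧ (∀ x, 0 < x → 0 < f x) ∧
    ∀ y : ℝ, 0 < y → Tendsto (fun x : ℝ => f (x * y) / f x) atTop (𝓝 1)

namespace LurothPartition

variable (α : LurothPartition)

/-- `α` is expansive of exponent `θ`: `t_n = ψ(n) n^{-θ}` with `ψ` slowly varying. -/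
def IsExpansive (θ : ℝ) : Prop :=
  0 ≤ θ ∧ ∃ ψ : ℝ → ℝ, IsSlowlyVarying ψ ∧
    ∀ n : ℕ, 1 ≤ n → α.t n = ψ n * (n : ℝ) ^ (-θ)

/-- `α` is eventually decreasing: `a_n < a_{n-1}` for all sufficiently large `n`. -/
def IsEventuallyDecreasing : Prop :=
  ∀ᶠ n : ℕ in atTop, α.a (n + 1) < α.a n

/-- The strict Jarník set: the points with infinite expansion whose digits satisfy
`s_n ≤ ℓ_n(x) < N s_n` for all `n ≥ 1`. -/
def jarnikSet (s : ℕ → ℕ) (N : ℝ) : Set ℝ :=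
  {x | α.HasInfiniteExpansion x ∧
    ∀ n : ℕ, 1 ≤ n → s n ≤ α.ell n x ∧ (α.ell n x : ℝ) < N * (s n : ℝ)}

end LurothPartition

/-- `σ = liminf log(s_1 ⋯ s_n) / ((1 + θ) log(s_1 ⋯ s_n) + θ log s_{n+1})`. -/
def jarnikExponent (s : ℕ → ℕ) (θ : ℝ) : ℝ :=
  liminf (fun n : ℕ =>
    Real.log (∏ i ∈ Finset.Icc 1 n, (s i : ℝ)) /
      ((1 + θ) * Real.log (∏ i ∈ Finset.Icc 1 n, (s i : ℝ)) + θ * Real.log (s (n + 1) : ℝ))) atTop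

end

noncomputable section

/-! ### Power bounds for monotone sequences from doubling -/

/-! Slow variation gives `t_n = n^(-θ + o(1))`, and monotonicity of the lengths upgrades this to
`a_n = n^(-(1+θ) + o(1))`. Write `P = log (s_1 ⋯ s_n)` and `Q = log s_{n+1}`. A cylinder with `n`
admissible digits has length about `exp (-(1+θ) P)`, and there are about `exp P` of them. The next
digit is at least `s_{n+1}`, so the set meets the cylinder only in a piece shorter by the factor
`t_{s_{n+1}}`, about `exp (-θ Q)`. Hence the ratio `P / ((1+θ) P + θ Q)`. Constants per digit, such
as `N`, are harmless: as `s_n → ∞`, they are eventually below `s_n^ε`.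

Upper bound: cover by these pieces at the levels where the ratio is close to its liminf
(`hausdorffMeasure_jarnikSet_le`, `exists_coverSum_le`).

Lower bound: no measure is constructed. Digits in `(s_n, 2 s_n]` code the mixed radix expansion of a
number `y ∈ [0,1)`. Decoding is `d`-Hölder for every positive `d < σ`
(`exists_abs_sub_le_of_lt_jarnikExponent`) and maps onto an interval, which forces dimension at
least `d`. -/

lemma exists_forall_le_of_eventually_antitone {u : ℕ → ℝ}
    (h : ∀ᶠ n in atTop, u (n + 1) ≤ u n) : ∃ C, 0 < C ∧ ∀ n, u n ≤ C := by
  obtain ⟨K, hK⟩ := eventually_atTop.1 h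
  have hfin : BddAbove (u '' Set.Iic K) := ((Set.finite_Iic K).image u).bddAbove
  obtain ⟨B, hB⟩ := hfin
  have hB' : ∀ n ≤ K, u n ≤ B := fun n hn => hB ⟨n, hn, rfl⟩
  refine ⟨max B 1, by positivity, fun n => ?_⟩
  rcases le_total n K with hn | hn
  · exact (hB' n hn).trans (le_max_left _ _)
  · refine le_trans ?_ (le_max_left _ _)
    induction n, hn using Nat.le_induction with
    | base => exact hB' K le_rfl
    | succ n hn ih => exact (hK n hn).trans ih

lemma two_pow_mul_rpow (β : ℝ) (k : ℕ) :
    ((2 : ℝ) ^ (k + 1)) ^ β = (2 : ℝ) ^ β * ((2 : ℝ) ^ k) ^ β := by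
  rw [pow_succ, Real.mul_rpow (by positivity) (by positivity), mul_comm]

lemma tendsto_two_pow_nat : Tendsto (fun k : ℕ => 2 ^ k) atTop (atTop : Filter ℕ) :=
  tendsto_pow_atTop_atTop_of_one_lt (by norm_num)

/-- Along powers of two, `u (2^k) * 2^(kβ)` is eventually nonincreasing, hence bounded; monotonicity
fills the dyadic blocks at the cost of `2^β`. Only the doubling ratio enters, so uniform convergence
for slowly varying functions is avoided. -/
lemma exists_le_mul_rpow_of_doubling {u : ℕ → ℝ} {β : ℝ} (hβ : 0 ≤ β)
    (hanti : ∀ m n, 1 ≤ m → m ≤ n → u n ≤ u m)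
    (h : ∀ᶠ n in atTop, u (2 * n) ≤ 2 ^ (-β) * u n) :
    ∃ C, 0 < C ∧ ∀ n : ℕ, 1 ≤ n → u n ≤ C * (n : ℝ) ^ (-β) := by
  obtain ⟨C, hC, hb⟩ := exists_forall_le_of_eventually_antitone
    (u := fun k => u (2 ^ k) * ((2 : ℝ) ^ k) ^ β) <| by
      filter_upwards [tendsto_two_pow_nat.eventually h] with k hk
      rw [two_pow_mul_rpow, pow_succ, mul_comm (2 ^ k) 2]
      rw [Real.rpow_neg two_pos.le, inv_mul_eq_div, le_div_iff₀ (by positivity)] at hk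
      calc u (2 * 2 ^ k) * ((2 : ℝ) ^ β * ((2 : ℝ) ^ k) ^ β)
          = (u (2 * 2 ^ k) * (2 : ℝ) ^ β) * ((2 : ℝ) ^ k) ^ β := by ring
        _ ≤ _ := by gcongr
  refine ⟨C * 2 ^ β, by positivity, fun n hn => ?_⟩
  have hk := Nat.pow_log_le_self 2 (Nat.one_le_iff_ne_zero.1 hn)
  have hk' := Nat.lt_pow_succ_log_self (b := 2) (by norm_num) n
  set k := Nat.log 2 n
  have hnpos : (0 : ℝ) < n := by exact_mod_cast hn
  rw [Real.rpow_neg hnpos.le, ← div_eq_mul_inv, le_div_iff₀ (by positivity)]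
  have h1 : (n : ℝ) ^ β ≤ 2 ^ β * ((2 : ℝ) ^ k) ^ β := by
    rw [← two_pow_mul_rpow]
    exact Real.rpow_le_rpow hnpos.le (by exact_mod_cast hk'.le) hβ
  have h2 := hanti _ _ (Nat.one_le_two_pow) hk
  have h3 := hb k
  have hp : (0 : ℝ) < (n : ℝ) ^ β := by positivity
  calc u n * (n : ℝ) ^ β ≤ u (2 ^ k) * (n : ℝ) ^ β := by gcongr
    -- The sign of `u` is unknown; the maximum with `0` allows the other factor to be enlarged.
    _ ≤ max (u (2 ^ k)) 0 * (n : ℝ) ^ β := by gcongr; exact le_max_left _ _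
    _ ≤ max (u (2 ^ k)) 0 * (2 ^ β * ((2 : ℝ) ^ k) ^ β) := by gcongr
    _ = max (u (2 ^ k) * ((2 : ℝ) ^ k) ^ β) 0 * 2 ^ β := by
        rw [← zero_mul (((2 : ℝ) ^ k) ^ β), ← max_mul_of_nonneg _ _ (by positivity), zero_mul]
        ring
    _ ≤ C * 2 ^ β := by gcongr; exact max_le h3 hC.le

lemma exists_mul_rpow_le_of_doubling {u : ℕ → ℝ} {β : ℝ} (hβ : 0 ≤ β)
    (hpos : ∀ n, 1 ≤ n → 0 < u n)
    (hanti : ∀ m n, 1 ≤ m → m ≤ n → u n ≤ u m)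
    (h : ∀ᶠ n in atTop, 2 ^ (-β) * u n ≤ u (2 * n)) :
    ∃ c, 0 < c ∧ ∀ n : ℕ, 1 ≤ n → c * (n : ℝ) ^ (-β) ≤ u n := by
  obtain ⟨C, hC, hb⟩ := exists_forall_le_of_eventually_antitone
    (u := fun k => (u (2 ^ k))⁻¹ * (((2 : ℝ) ^ k) ^ β)⁻¹) <| by
      filter_upwards [tendsto_two_pow_nat.eventually h] with k hk
      rw [two_pow_mul_rpow, pow_succ, mul_comm (2 ^ k) 2, ← mul_inv, ← mul_inv]
      have := hpos (2 ^ k) Nat.one_le_two_pow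
      rw [Real.rpow_neg two_pos.le, inv_mul_eq_div, div_le_iff₀ (by positivity)] at hk
      apply inv_anti₀ (by positivity)
      calc u (2 ^ k) * ((2 : ℝ) ^ k) ^ β ≤ (u (2 * 2 ^ k) * (2 : ℝ) ^ β) * ((2 : ℝ) ^ k) ^ β := by
            gcongr
        _ = _ := by ring
  refine ⟨C⁻¹ * (2 ^ β)⁻¹, by positivity, fun n hn => ?_⟩
  have hk := Nat.pow_log_le_self 2 (Nat.one_le_iff_ne_zero.1 hn)
  have hk' := Nat.lt_pow_succ_log_self (b := 2) (by norm_num) n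
  set k := Nat.log 2 n
  have hnpos : (0 : ℝ) < n := by exact_mod_cast hn
  have h3 := hb (k + 1)
  have hp := hpos (2 ^ (k + 1)) Nat.one_le_two_pow
  simp only [two_pow_mul_rpow, ← mul_inv] at h3
  rw [inv_le_comm₀ (by positivity) hC] at h3
  have h1 : ((2 : ℝ) ^ k) ^ β ≤ (n : ℝ) ^ β :=
    Real.rpow_le_rpow (by positivity) (by exact_mod_cast hk) hβ
  rw [Real.rpow_neg hnpos.le, ← div_eq_mul_inv, ← div_eq_mul_inv,
    div_div, div_le_iff₀ (by positivity)]
  calc C⁻¹ ≤ u (2 ^ (k + 1)) * (2 ^ β * ((2 : ℝ) ^ k) ^ β) := h3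
    _ ≤ u n * (2 ^ β * (n : ℝ) ^ β) := by
      have := hanti n _ hn hk'.le
      have := hpos n hn
      gcongr

namespace LurothPartition

variable (α : LurothPartition)

/-! ### Tails -/

lemma summable_a_add {n : ℕ} (hn : 1 ≤ n) : Summable fun k => α.a (n + k) := by
  obtain ⟨m, rfl⟩ := Nat.exists_eq_add_of_le' hn
  have := (summable_nat_add_iff m).2 α.hasSum_a.summable
  refine this.congr fun k => ?_
  congr 1; ring

lemma t_eq_add {n : ℕ} (hn : 1 ≤ n) : α.t n = α.a n + α.t (n + 1) := by
  rw [t, (α.summable_a_add hn).tsum_eq_zero_add, t]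
  simp only [add_zero]
  congr 2; ext k; congr 1; ring

lemma t_one : α.t 1 = 1 := by
  rw [t, ← α.hasSum_a.tsum_eq]
  congr 1; ext k; rw [add_comm]

lemma t_pos {n : ℕ} (hn : 1 ≤ n) : 0 < α.t n :=
  (α.summable_a_add hn).tsum_pos (fun k => (α.a_pos _ (by omega)).le) 0 (α.a_pos _ (by omega))

lemma t_anti {m n : ℕ} (hm : 1 ≤ m) (hmn : m ≤ n) : α.t n ≤ α.t m := by
  induction n, hmn using Nat.le_induction with
  | base => exact le_rfl
  | succ n hn ih =>
    have := α.t_eq_add (hm.trans hn)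
    have := α.a_pos n (hm.trans hn)
    linarith

lemma t_eq_sum_add {m : ℕ} (hm : 1 ≤ m) (k : ℕ) :
    α.t m = ∑ i ∈ Finset.range k, α.a (m + i) + α.t (m + k) := by
  induction k with
  | zero => simp
  | succ k ih =>
    rw [ih, Finset.sum_range_succ, α.t_eq_add (n := m + k) (by omega)]
    ring_nf

lemma t_le_one {n : ℕ} (hn : 1 ≤ n) : α.t n ≤ 1 := α.t_one ▸ α.t_anti le_rfl hn

lemma a_le_one {n : ℕ} (hn : 1 ≤ n) : α.a n ≤ 1 := by
  have := α.t_eq_add hn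
  have := α.t_le_one hn
  have := α.t_pos (n := n + 1) (by omega)
  linarith

variable {α} {θ : ℝ}

/-- All that is needed from slow variation: the limit at `y = 2`. -/
lemma IsExpansive.tendsto_t_two_mul_div (h : α.IsExpansive θ) :
    Tendsto (fun n : ℕ => α.t (2 * n) / α.t n) atTop (𝓝 (2 ^ (-θ))) := by
  obtain ⟨-, ψ, ⟨-, hpos, hlim⟩, ht⟩ := h
  have h1 := ((hlim 2 two_pos).comp tendsto_natCast_atTop_atTop).mul_const ((2 : ℝ) ^ (-θ))
  rw [one_mul] at h1
  refine h1.congr' ?_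
  filter_upwards [eventually_ge_atTop 1] with n hn
  have hn0 : (0 : ℝ) < n := by exact_mod_cast hn
  rw [ht n hn, ht (2 * n) (by omega)]
  push_cast
  rw [Real.mul_rpow two_pos.le hn0.le]
  have := hpos n hn0
  have := Real.rpow_pos_of_pos hn0 (-θ)
  simp only [Function.comp_apply]
  rw [mul_comm (n : ℝ) 2]
  field_simp

lemma IsExpansive.exists_t_le (h : α.IsExpansive θ) {ε : ℝ} (hε : 0 < ε) (hεθ : ε ≤ θ) :
    ∃ C, 0 < C ∧ ∀ n : ℕ, 1 ≤ n → α.t n ≤ C * (n : ℝ) ^ (-(θ - ε)) := by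
  refine exists_le_mul_rpow_of_doubling (by linarith) (fun m n => α.t_anti) ?_
  have hlt : (2 : ℝ) ^ (-θ) < 2 ^ (-(θ - ε)) :=
    Real.rpow_lt_rpow_of_exponent_lt (by norm_num) (by linarith)
  filter_upwards [h.tendsto_t_two_mul_div.eventually_lt_const hlt, eventually_ge_atTop 1]
    with n hn h1
  exact ((div_lt_iff₀ (α.t_pos h1)).1 hn).le

lemma IsExpansive.exists_le_t (h : α.IsExpansive θ) {ε : ℝ} (hε : 0 < ε) :
    ∃ c, 0 < c ∧ ∀ n : ℕ, 1 ≤ n → c * (n : ℝ) ^ (-(θ + ε)) ≤ α.t n := by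
  refine exists_mul_rpow_le_of_doubling (by linarith [h.1]) (fun n => α.t_pos)
    (fun m n => α.t_anti) ?_
  have hlt : (2 : ℝ) ^ (-(θ + ε)) < 2 ^ (-θ) :=
    Real.rpow_lt_rpow_of_exponent_lt (by norm_num) (by linarith)
  filter_upwards [h.tendsto_t_two_mul_div.eventually_const_lt hlt, eventually_ge_atTop 1]
    with n hn h1
  exact ((lt_div_iff₀ (α.t_pos h1)).1 hn).le

/-! ### Lengths of atoms -/

lemma exists_forall_ge_one {P : ℕ → ℝ → Prop}
    (hmono : ∀ n C D, 1 ≤ n → C ≤ D → P n C → P n D) (hall : ∀ n, 1 ≤ n → ∃ C, P n C)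
    (hev : ∃ C, ∀ᶠ n in atTop, P n C) : ∃ C, 0 < C ∧ ∀ n, 1 ≤ n → P n C := by
  obtain ⟨C, hC⟩ := hev
  obtain ⟨K, hK⟩ := eventually_atTop.1 hC
  choose! D hD using hall
  obtain ⟨B, hB⟩ := ((Set.finite_Iic K).image D).bddAbove
  refine ⟨max (max B C) 1, by positivity, fun n hn => ?_⟩
  rcases le_total n K with h | h
  · exact hmono n _ _ hn ((hB ⟨n, h, rfl⟩).trans ((le_max_left _ _).trans (le_max_left _ _)))
      (hD n hn)
  · exact hmono n _ _ hn ((le_max_right _ _).trans (le_max_left _ _)) (hK n h)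

lemma IsEventuallyDecreasing.exists_anti (h : α.IsEventuallyDecreasing) :
    ∃ K, 1 ≤ K ∧ ∀ m n, K ≤ m → m ≤ n → α.a n ≤ α.a m := by
  obtain ⟨K, hK⟩ := eventually_atTop.1 h
  refine ⟨max K 1, le_max_right _ _, fun m n hm hmn => ?_⟩
  induction n, hmn using Nat.le_induction with
  | base => exact le_rfl
  | succ n hn ih => exact (hK n (by omega)).le.trans ih

/-- With `m = ⌈n/2⌉`, the `m` lengths of index `m, …, 2m - 1 ≤ n` are all at least `a_n`, so `m a_n
≤ t_m`. -/
lemma exists_a_le (hdec : α.IsEventuallyDecreasing) (hexp : α.IsExpansive θ) {ε : ℝ} (hε : 0 < ε)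
    (hεθ : ε ≤ θ) : ∃ C, 0 < C ∧ ∀ n : ℕ, 1 ≤ n → α.a n ≤ C * (n : ℝ) ^ (-(1 + θ - ε)) := by
  obtain ⟨K, hK1, hK⟩ := hdec.exists_anti
  obtain ⟨C, hC, ht⟩ := hexp.exists_t_le hε hεθ
  refine exists_forall_ge_one (P := fun n C => α.a n ≤ C * (n : ℝ) ^ (-(1 + θ - ε))) ?_ ?_
    ⟨C * 2 ^ (θ - ε) * 2, ?_⟩
  · intro n C D _ hCD h
    exact h.trans (by gcongr)
  · intro n hn
    have : (0 : ℝ) < (n : ℝ) ^ (-(1 + θ - ε)) := Real.rpow_pos_of_pos (by exact_mod_cast hn) _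
    exact ⟨α.a n / (n : ℝ) ^ (-(1 + θ - ε)), by rw [div_mul_cancel₀ _ this.ne']⟩
  filter_upwards [eventually_ge_atTop (2 * K)] with n hn
  set m := n - n / 2 with hm
  have hm1 : K ≤ m := by omega
  have hn0 : (0 : ℝ) < n := by exact_mod_cast (by omega : 0 < n)
  have hm0 : (0 : ℝ) < m := by exact_mod_cast (by omega : 0 < m)
  have hsum : (m : ℝ) * α.a n ≤ α.t m := by
    rw [α.t_eq_sum_add (hK1.trans hm1) m]
    have h1 : ∑ i ∈ Finset.range m, α.a n ≤ ∑ i ∈ Finset.range m, α.a (m + i) + 0 := by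
      rw [add_zero]
      refine Finset.sum_le_sum fun i hi => hK _ _ (by omega) ?_
      have := Finset.mem_range.1 hi
      omega
    have h2 := α.t_pos (n := m + m) (by omega)
    simp only [Finset.sum_const, Finset.card_range, nsmul_eq_mul] at h1
    linarith
  have hnm : (n : ℝ) ≤ 2 * m := by exact_mod_cast (by omega : n ≤ 2 * m)
  have h3 := ht m (by omega)
  have h4 : (m : ℝ) ^ (-(θ - ε)) ≤ 2 ^ (θ - ε) * (n : ℝ) ^ (-(θ - ε)) := by
    have : ((n : ℝ) / 2) ^ (-(θ - ε)) = 2 ^ (θ - ε) * (n : ℝ) ^ (-(θ - ε)) := by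
      rw [Real.div_rpow hn0.le two_pos.le, Real.rpow_neg two_pos.le, div_inv_eq_mul, mul_comm]
    rw [← this]
    exact Real.rpow_le_rpow_of_nonpos (by positivity) (by linarith) (by linarith)
  have h5 : (n : ℝ) ^ (-(1 + θ - ε)) = (n : ℝ) ^ (-(θ - ε)) / n := by
    rw [show -(1 + θ - ε) = -(θ - ε) - 1 by ring, Real.rpow_sub_one hn0.ne']
  rw [h5, ← mul_div_assoc, le_div_iff₀ hn0]
  have ha := (α.a_pos n (by omega)).le
  calc α.a n * n ≤ α.a n * (2 * m) := by gcongr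
    _ = 2 * (m * α.a n) := by ring
    _ ≤ 2 * (C * (2 ^ (θ - ε) * (n : ℝ) ^ (-(θ - ε)))) := by
      refine mul_le_mul_of_nonneg_left (hsum.trans (h3.trans ?_)) two_pos.le
      gcongr
    _ = _ := by ring

/-- Here `n a_n ≥ t_n - t_{2n} ≥ (1 - r) t_n`, where `r < 1` exists because `2^(-θ) < 1`. -/
lemma exists_le_a (hθ : 0 < θ) (hdec : α.IsEventuallyDecreasing) (hexp : α.IsExpansive θ) {ε : ℝ}
    (hε : 0 < ε) : ∃ c, 0 < c ∧ ∀ n : ℕ, 1 ≤ n → c * (n : ℝ) ^ (-(1 + θ + ε)) ≤ α.a n := by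
  obtain ⟨K, hK1, hK⟩ := hdec.exists_anti
  obtain ⟨c, hc, ht⟩ := hexp.exists_le_t hε
  have hlt : (2 : ℝ) ^ (-θ) < 1 := Real.rpow_lt_one_of_one_lt_of_neg (by norm_num) (by linarith)
  obtain ⟨r, hr, hr1⟩ := exists_between hlt
  suffices h : ∃ C, 0 < C ∧ ∀ n : ℕ, 1 ≤ n → (n : ℝ) ^ (-(1 + θ + ε)) ≤ C * α.a n by
    obtain ⟨C, hC, h⟩ := h
    refine ⟨C⁻¹, by positivity, fun n hn => ?_⟩
    rw [inv_mul_eq_div, div_le_iff₀ hC, mul_comm (α.a n)]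
    exact h n hn
  refine exists_forall_ge_one (P := fun n C => (n : ℝ) ^ (-(1 + θ + ε)) ≤ C * α.a n) ?_ ?_
    ⟨((1 - r) * c)⁻¹, ?_⟩
  · intro n C D hn hCD h
    have := α.a_pos n hn
    exact h.trans (by gcongr)
  · intro n hn
    have := α.a_pos n hn
    exact ⟨(n : ℝ) ^ (-(1 + θ + ε)) / α.a n, by rw [div_mul_cancel₀ _ this.ne']⟩
  filter_upwards [eventually_ge_atTop K, hexp.tendsto_t_two_mul_div.eventually_lt_const hr]
    with n hn hn2
  have hn1 : 1 ≤ n := hK1.trans hn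
  have hn0 : (0 : ℝ) < n := by exact_mod_cast hn1
  rw [div_lt_iff₀ (α.t_pos hn1)] at hn2
  have h1 : ∑ i ∈ Finset.range n, α.a (n + i) ≤ ∑ i ∈ Finset.range n, α.a n :=
    Finset.sum_le_sum fun i _ => hK _ _ hn (by omega)
  have h2 := α.t_eq_sum_add hn1 n
  rw [← two_mul] at h2
  simp only [Finset.sum_const, Finset.card_range, nsmul_eq_mul] at h1
  have h3 : (1 - r) * α.t n ≤ n * α.a n := by linarith
  have h5 : (n : ℝ) ^ (-(1 + θ + ε)) = (n : ℝ) ^ (-(θ + ε)) / n := by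
    rw [show -(1 + θ + ε) = -(θ + ε) - 1 by ring, Real.rpow_sub_one hn0.ne']
  have hr0 : 0 < 1 - r := by linarith
  rw [h5, div_le_iff₀ hn0, inv_mul_eq_div, div_mul_eq_mul_div, le_div_iff₀ (by positivity)]
  calc (n : ℝ) ^ (-(θ + ε)) * ((1 - r) * c) = (1 - r) * (c * (n : ℝ) ^ (-(θ + ε))) := by ring
    _ ≤ (1 - r) * α.t n := by gcongr; exact ht n hn1
    _ ≤ _ := by linarith

end LurothPartition

namespace LurothPartition

variable (α : LurothPartition)

/-! ### Orbits and digits -/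

variable {α} in
lemma mem_atom_digit {x : ℝ} (h : 1 ≤ α.digit x) : x ∈ α.atom (α.digit x) := by
  have hne : {n : ℕ | 1 ≤ n ∧ x ∈ α.atom n}.Nonempty := by
    by_contra hne
    rw [Set.not_nonempty_iff_eq_empty] at hne
    simp [digit, hne] at h
  exact (Nat.sInf_mem hne).2

variable {α} in
lemma eq_sub_mul_map {x : ℝ} (h : 1 ≤ α.digit x) :
    x = α.t (α.digit x) - α.a (α.digit x) * α.map x := by
  have := α.a_pos _ h
  rw [map, if_neg (by omega)]
  field_simp
  ring

variable {α} in
lemma digit_eq_of_mem_atom {x : ℝ} {n : ℕ} (hn : 1 ≤ n) (h : x ∈ α.atom n) : α.digit x = n := by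
  have hle : α.digit x ≤ n := Nat.sInf_le ⟨hn, h⟩
  have hmem := Nat.sInf_mem (s := {n : ℕ | 1 ≤ n ∧ x ∈ α.atom n}) ⟨n, hn, h⟩
  by_contra hne
  have hlt : α.digit x + 1 ≤ n := by omega
  have h1 : α.t n ≤ α.t (α.digit x + 1) := α.t_anti (by omega) hlt
  have h2 : α.t (α.digit x + 1) < x := hmem.2.1
  have h3 : x ≤ α.t n := h.2
  linarith

/-- A sequence that is followed by the inverse branches of the Lüroth map with digits `l`. -/
def IsOrbit (l : ℕ → ℕ) (x : ℕ → ℝ) : Prop :=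
  ∀ k, x k = α.t (l k) - α.a (l k) * x (k + 1)

variable {α} in
lemma isOrbit_iterate {x : ℝ} (h : ∀ n, 1 ≤ n → 1 ≤ α.ell n x) :
    α.IsOrbit (fun k => α.ell (k + 1) x) (fun k => α.map^[k] x) := by
  intro k
  have := eq_sub_mul_map (α := α) (x := α.map^[k] x) (h (k + 1) (by omega))
  rw [← Function.iterate_succ_apply' α.map] at this
  exact this

variable {α} in
lemma IsOrbit.abs_sub_eq {l l' : ℕ → ℕ} {x y : ℕ → ℝ} (hx : α.IsOrbit l x) (hy : α.IsOrbit l' y)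
    (hl : ∀ k, 1 ≤ l k) (n : ℕ) (h : ∀ k < n, l k = l' k) :
    |x 0 - y 0| = (∏ i ∈ Finset.range n, α.a (l i)) * |x n - y n| := by
  induction n with
  | zero => simp
  | succ n ih =>
    rw [ih fun k hk => h k (by omega), Finset.prod_range_succ, hx n, hy n, ← h n (by omega)]
    have : α.t (l n) - α.a (l n) * x (n + 1) - (α.t (l n) - α.a (l n) * y (n + 1))
        = α.a (l n) * -(x (n + 1) - y (n + 1)) := by ring
    rw [this, abs_mul, abs_neg, abs_of_pos (α.a_pos _ (hl n)), mul_assoc]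

/-- The image of `0` under the first `n` inverse branches given by the digits `l`. -/
def approx : ℕ → (ℕ → ℕ) → ℝ
  | 0, _ => 0
  | n + 1, l => α.t (l 0) - α.a (l 0) * approx n fun k => l (k + 1)

lemma sub_mul_mem_Icc {n : ℕ} (hn : 1 ≤ n) {z : ℝ} (hz : z ∈ Set.Icc (0 : ℝ) 1) :
    α.t n - α.a n * z ∈ Set.Icc (α.t (n + 1)) (α.t n) := by
  have := α.a_pos n hn
  have := α.t_eq_add hn
  constructor <;> nlinarith [hz.1, hz.2]

lemma approx_mem_Icc (n : ℕ) {l : ℕ → ℕ} (hl : ∀ k, 1 ≤ l k) :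
    α.approx n l ∈ Set.Icc (0 : ℝ) 1 := by
  induction n generalizing l with
  | zero => simp [approx]
  | succ n ih =>
    have := α.sub_mul_mem_Icc (hl 0) (ih (l := fun k => l (k + 1)) fun k => hl _)
    exact ⟨(α.t_pos (by omega)).le.trans this.1, this.2.trans (α.t_le_one (hl 0))⟩

lemma t_two_lt_one : α.t 2 < 1 := by
  have h := α.t_eq_add (n := 1) le_rfl
  have := α.a_pos 1 le_rfl
  rw [α.t_one] at h
  norm_num at h
  linarith

lemma a_le_t {n : ℕ} (hn : 1 ≤ n) : α.a n ≤ α.t n := by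
  linarith [α.t_eq_add hn, α.t_pos (n := n + 1) (by omega)]

lemma dist_approx_succ_le (n : ℕ) {l : ℕ → ℕ} (hl : ∀ k, 2 ≤ l k) :
    dist (α.approx n l) (α.approx (n + 1) l) ≤ 1 * α.t 2 ^ n := by
  rw [one_mul]
  induction n generalizing l with
  | zero =>
    have := α.approx_mem_Icc 1 (l := l) fun k => le_trans (by norm_num) (hl k)
    rw [show α.approx 0 l = 0 from rfl, dist_comm, Real.dist_0_eq_abs, abs_of_nonneg this.1]
    simpa using this.2
  | succ n ih =>
    have h0 : 1 ≤ l 0 := le_trans (by norm_num) (hl 0)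
    have h1 : α.a (l 0) ≤ α.t 2 := (α.a_le_t h0).trans (α.t_anti (by norm_num) (hl 0))
    have h2 := ih (l := fun k => l (k + 1)) fun k => hl _
    rw [approx, approx, Real.dist_eq, sub_sub_sub_cancel_left, ← mul_sub, abs_mul,
      abs_of_pos (α.a_pos _ h0), pow_succ', abs_sub_comm]
    rw [Real.dist_eq] at h2
    have := α.t_pos (n := 2) (by norm_num)
    gcongr

/-- Digits at least `2` give contraction ratios at most `t_2 < 1`, so `approx` converges
geometrically for every shift of `l`. -/
lemma exists_isOrbit {l : ℕ → ℕ} (hl : ∀ k, 2 ≤ l k) :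
    ∃ x : ℕ → ℝ, α.IsOrbit l x ∧ ∀ k, 0 < x k ∧ x k ≤ α.t 2 := by
  have hl1 : ∀ k, 1 ≤ l k := fun k => le_trans (by norm_num) (hl k)
  have hconv : ∀ k, ∃ z, Tendsto (fun n => α.approx n fun i => l (k + i)) atTop (𝓝 z) := fun k =>
    cauchySeq_tendsto_of_complete
      (cauchySeq_of_le_geometric _ _ α.t_two_lt_one fun n => α.dist_approx_succ_le n fun i => hl _)
  choose x hx using hconv
  have hxI : ∀ k, x k ∈ Set.Icc (0 : ℝ) 1 := fun k =>
    isClosed_Icc.mem_of_tendsto (hx k)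
      (Eventually.of_forall fun n => α.approx_mem_Icc n fun i => hl1 _)
  have horb : α.IsOrbit l x := fun k => by
    refine tendsto_nhds_unique ((tendsto_add_atTop_iff_nat 1).2 (hx k)) ?_
    have h := ((hx (k + 1)).const_mul (α.a (l k))).const_sub (α.t (l k))
    refine h.congr fun n => ?_
    rw [approx]
    simp only [add_zero]
    congr 3; ext i; congr 1; ring
  refine ⟨x, horb, fun k => ?_⟩
  have h := α.sub_mul_mem_Icc (hl1 k) (hxI (k + 1))
  rw [← horb k] at h
  exact ⟨(α.t_pos (by omega)).trans_le h.1, h.2.trans (α.t_anti (by norm_num) (hl k))⟩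

variable {α} in
lemma IsOrbit.iterate_eq {l : ℕ → ℕ} {x : ℕ → ℝ} (hx : α.IsOrbit l x) (hl : ∀ k, 2 ≤ l k)
    (hb : ∀ k, 0 < x k ∧ x k ≤ α.t 2) :
    α.HasInfiniteExpansion (x 0) ∧ ∀ k, α.ell (k + 1) (x 0) = l k := by
  have hl1 : ∀ k, 1 ≤ l k := fun k => le_trans (by norm_num) (hl k)
  have hd : ∀ k, α.digit (x k) = l k := fun k => by
    -- The strict bound `x (k + 1) ≤ t_2 < 1` keeps `x k` off the excluded left endpoint of the
    -- atom.
    refine digit_eq_of_mem_atom (hl1 k) ?_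
    have h1 := α.t_eq_add (hl1 k)
    have h2 := α.a_pos _ (hl1 k)
    have h3 := hb (k + 1)
    have h4 := α.t_two_lt_one
    have h5 := hx k
    constructor <;> nlinarith
  have hm : ∀ k, α.map (x k) = x (k + 1) := fun k => by
    have h2 := α.a_pos _ (hl1 k)
    have h := eq_sub_mul_map (α := α) (x := x k) (by rw [hd]; exact hl1 k)
    rw [hd] at h
    have h5 := hx k
    exact mul_left_cancel₀ h2.ne' (by linarith)
  have hit : ∀ k, α.map^[k] (x 0) = x k := fun k => by
    induction k with
    | zero => rfl
    | succ k ih => rw [Function.iterate_succ_apply', ih, hm]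
  refine ⟨⟨⟨(hb 0).1.le, (hb 0).2.trans α.t_two_lt_one.le⟩, fun k => ?_⟩, fun k => ?_⟩
  · rw [hit]; exact (hb k).1.ne'
  · rw [ell, Nat.add_sub_cancel, hit, hd]

variable {α} in
-- The bound by `t (s (k + 1))` is the source of the term `θ log s_{n+1}` in the exponent.
lemma jarnikSet_orbit {s : ℕ → ℕ} (hs_pos : ∀ n, 1 ≤ n → 1 ≤ s n) {N : ℝ} {x : ℝ}
    (hx : x ∈ α.jarnikSet s N) :
    α.IsOrbit (fun k => α.ell (k + 1) x) (fun k => α.map^[k] x) ∧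
      ∀ k, α.map^[k] x ∈ Set.Icc 0 (α.t (s (k + 1))) := by
  have hell : ∀ n, 1 ≤ n → 1 ≤ α.ell n x := fun n hn => (hs_pos n hn).trans (hx.2 n hn).1
  refine ⟨isOrbit_iterate hell, fun k => ?_⟩
  have h1 := hell (k + 1) (by omega)
  have h := mem_atom_digit (α := α) (x := α.map^[k] x) h1
  exact ⟨(α.t_pos (by omega)).le.trans h.1.le,
    h.2.trans (α.t_anti (hs_pos _ (by omega)) (hx.2 (k + 1) (by omega)).1)⟩

end LurothPartition

/-! ### Logarithmic sums -/

/-- `log (s_1 ⋯ s_n)` as a sum. -/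
def logSum (s : ℕ → ℕ) (n : ℕ) : ℝ := ∑ i ∈ Finset.range n, Real.log (s (i + 1))

/-- The quotient of the products is eventually nonincreasing, so the finitely many bad factors cost
one constant for all `n`. -/
lemma exists_prod_le_of_eventually_le {u v : ℕ → ℝ} (hu : ∀ n, 0 < u n) (hv : ∀ n, 0 < v n)
    (h : ∀ᶠ n in atTop, u n ≤ v n) :
    ∃ C, 0 < C ∧ ∀ n, ∏ i ∈ Finset.range n, u i ≤ C * ∏ i ∈ Finset.range n, v i := by
  obtain ⟨C, hC, hb⟩ := exists_forall_le_of_eventually_antitone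
    (u := fun n => ∏ i ∈ Finset.range n, (u i / v i)) <| by
      filter_upwards [h] with n hn
      rw [Finset.prod_range_succ]
      exact mul_le_of_le_one_right (Finset.prod_nonneg fun i _ => (div_pos (hu i) (hv i)).le)
        ((div_le_one (hv n)).2 hn)
  refine ⟨C, hC, fun n => ?_⟩
  have := hb n
  simp only [Finset.prod_div_distrib] at this
  rwa [div_le_iff₀ (Finset.prod_pos fun i _ => hv i)] at this

lemma tendsto_log_digit {s : ℕ → ℕ} (hs : Tendsto s atTop atTop) :
    Tendsto (fun n => Real.log (s (n + 1))) atTop atTop :=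
  Real.tendsto_log_atTop.comp
    (tendsto_natCast_atTop_atTop.comp ((tendsto_add_atTop_iff_nat 1).2 hs))

lemma eventually_const_le_digit_rpow {s : ℕ → ℕ} (hs : Tendsto s atTop atTop) (B : ℝ) {ε : ℝ} (hε : 0 < ε) :
    ∀ᶠ n in atTop, B ≤ (s (n + 1) : ℝ) ^ ε :=
  ((tendsto_rpow_atTop hε).comp
    (tendsto_natCast_atTop_atTop.comp ((tendsto_add_atTop_iff_nat 1).2 hs))).eventually_ge_atTop B

lemma log_digit_nonneg {s : ℕ → ℕ} (hs_pos : ∀ n, 1 ≤ n → 1 ≤ s n)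
    (n : ℕ) : 0 ≤ Real.log (s (n + 1)) :=
  Real.log_nonneg (by exact_mod_cast hs_pos (n + 1) (by omega))

lemma digit_cast_pos {s : ℕ → ℕ} (hs_pos : ∀ n, 1 ≤ n → 1 ≤ s n) (n : ℕ) : (0 : ℝ) < s (n + 1) := by
  exact_mod_cast hs_pos (n + 1) (by omega)

lemma logSum_nonneg {s : ℕ → ℕ} (hs_pos : ∀ n, 1 ≤ n → 1 ≤ s n) (n : ℕ) : 0 ≤ logSum s n :=
  Finset.sum_nonneg fun i _ => log_digit_nonneg hs_pos i

lemma log_prod_Icc_eq_logSum {s : ℕ → ℕ} (hs_pos : ∀ n, 1 ≤ n → 1 ≤ s n) (n : ℕ) :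
    Real.log (∏ i ∈ Finset.Icc 1 n, (s i : ℝ)) = logSum s n := by
  induction n with
  | zero => simp [logSum]
  | succ n ih =>
    rw [Finset.prod_Icc_succ_top (by omega), Real.log_mul _ (digit_cast_pos hs_pos n).ne', ih,
      logSum, logSum, Finset.sum_range_succ]
    exact Finset.prod_ne_zero_iff.2 fun i hi => by
      have := hs_pos i (Finset.mem_Icc.1 hi).1
      positivity

lemma prod_rpow_eq_exp {s : ℕ → ℕ} (hs_pos : ∀ n, 1 ≤ n → 1 ≤ s n) (p : ℝ) (n : ℕ) :
    ∏ i ∈ Finset.range n, (s (i + 1) : ℝ) ^ p = Real.exp (p * logSum s n) := by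
  rw [logSum, Finset.mul_sum, Real.exp_sum]
  refine Finset.prod_congr rfl fun i _ => ?_
  rw [Real.rpow_def_of_pos (digit_cast_pos hs_pos i), mul_comm]

lemma tendsto_logSum {s : ℕ → ℕ} (hs_pos : ∀ n, 1 ≤ n → 1 ≤ s n)
    (hs : Tendsto s atTop atTop) : Tendsto (logSum s) atTop atTop := by
  refine (tendsto_add_atTop_iff_nat 1).1 ?_
  refine tendsto_atTop_mono (fun n => ?_) (tendsto_log_digit hs)
  rw [logSum, Finset.sum_range_succ]
  exact le_add_of_nonneg_left (logSum_nonneg hs_pos n)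

lemma jarnikExponent_eq {s : ℕ → ℕ} (hs_pos : ∀ n, 1 ≤ n → 1 ≤ s n)
    (θ : ℝ) : jarnikExponent s θ = liminf (fun n : ℕ =>
    logSum s n / ((1 + θ) * logSum s n + θ * Real.log (s (n + 1) : ℝ))) atTop := by
  simp only [jarnikExponent, log_prod_Icc_eq_logSum hs_pos]

/-- Boundedness makes the real `liminf` a genuine one. Where the denominator vanishes, the ratio is
`0` by convention. -/
lemma ratio_mem_Icc {s : ℕ → ℕ} (hs_pos : ∀ n, 1 ≤ n → 1 ≤ s n) {θ : ℝ} (hθ : 0 < θ) (n : ℕ) :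
    logSum s n / ((1 + θ) * logSum s n + θ * Real.log (s (n + 1) : ℝ)) ∈ Set.Icc (0 : ℝ) 1 := by
  have h1 := logSum_nonneg hs_pos n
  have h2 := log_digit_nonneg hs_pos n
  constructor
  · positivity
  · refine div_le_one_of_le₀ ?_ (by positivity)
    nlinarith [mul_nonneg hθ.le h1, mul_nonneg hθ.le h2]

lemma eventually_denom_pos {s : ℕ → ℕ} (hs_pos : ∀ n, 1 ≤ n → 1 ≤ s n)
    {θ : ℝ} (hθ : 0 < θ) (hs : Tendsto s atTop atTop) :
    ∀ᶠ n in atTop, 0 < (1 + θ) * logSum s n + θ * Real.log (s (n + 1) : ℝ) := by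
  filter_upwards [(tendsto_logSum hs_pos hs).eventually_gt_atTop 0] with n hn
  have h2 := log_digit_nonneg hs_pos n
  positivity

lemma frequently_of_jarnikExponent_lt {s : ℕ → ℕ} (hs_pos : ∀ n, 1 ≤ n → 1 ≤ s n)
    {θ : ℝ} (hθ : 0 < θ) (hs : Tendsto s atTop atTop) {b : ℝ}
    (hb : jarnikExponent s θ < b) : ∃ᶠ n in atTop,
      logSum s n < b * ((1 + θ) * logSum s n + θ * Real.log (s (n + 1) : ℝ)) := by
  rw [jarnikExponent_eq hs_pos] at hb
  have hco : IsCoboundedUnder (· ≥ ·) atTop fun n : ℕ =>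
      logSum s n / ((1 + θ) * logSum s n + θ * Real.log (s (n + 1) : ℝ)) :=
    (isBoundedUnder_of ⟨1, fun n => (ratio_mem_Icc hs_pos hθ n).2⟩).isCoboundedUnder_ge
  refine ((frequently_lt_of_liminf_lt hco hb).and_eventually
    (eventually_denom_pos hs_pos hθ hs)).mono fun n hn => ?_
  exact (div_lt_iff₀ hn.2).1 hn.1

lemma eventually_of_lt_jarnikExponent {s : ℕ → ℕ} (hs_pos : ∀ n, 1 ≤ n → 1 ≤ s n)
    {θ : ℝ} (hθ : 0 < θ) (hs : Tendsto s atTop atTop) {b : ℝ}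
    (hb : b < jarnikExponent s θ) : ∀ᶠ n in atTop,
      b * ((1 + θ) * logSum s n + θ * Real.log (s (n + 1) : ℝ)) < logSum s n := by
  rw [jarnikExponent_eq hs_pos] at hb
  filter_upwards [eventually_lt_of_lt_liminf hb
    (isBoundedUnder_of ⟨0, fun n => (ratio_mem_Icc hs_pos hθ n).1⟩),
    eventually_denom_pos hs_pos hθ hs] with n h1 h2
  exact (lt_div_iff₀ h2).1 h1

lemma jarnikExponent_nonneg {s : ℕ → ℕ} (hs_pos : ∀ n, 1 ≤ n → 1 ≤ s n)
    {θ : ℝ} (hθ : 0 < θ) : 0 ≤ jarnikExponent s θ := by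
  rw [jarnikExponent_eq hs_pos]
  refine le_liminf_of_le
    (isBoundedUnder_of ⟨1, fun n => (ratio_mem_Icc hs_pos hθ n).2⟩).isCoboundedUnder_ge
    (Eventually.of_forall fun n => (ratio_mem_Icc hs_pos hθ n).1)

lemma jarnikExponent_le_one {s : ℕ → ℕ} (hs_pos : ∀ n, 1 ≤ n → 1 ≤ s n)
    {θ : ℝ} (hθ : 0 < θ) : jarnikExponent s θ ≤ 1 := by
  rw [jarnikExponent_eq hs_pos]
  refine liminf_le_of_frequently_le
    (Eventually.of_forall fun n => (ratio_mem_Icc hs_pos hθ n).2).frequently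
    (isBoundedUnder_of ⟨0, fun n => (ratio_mem_Icc hs_pos hθ n).1⟩)

/-! ### Upper bound -/

namespace LurothPartition

variable {α : LurothPartition} {s : ℕ → ℕ} {N θ : ℝ}

/-- The admissible words of length `n`. -/
def words (s : ℕ → ℕ) (N : ℝ) (n : ℕ) : Finset (Fin n → ℕ) :=
  Fintype.piFinset fun i : Fin n => Finset.Ico (s (i + 1)) ⌈N * s (i + 1)⌉₊

variable (α) in
/-- The bound of the `d`-dimensional sum of the natural cover of order `n`. -/
def coverSum (s : ℕ → ℕ) (N d : ℝ) (n : ℕ) : ℝ :=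
  (∏ i ∈ Finset.range n, ∑ l ∈ Finset.Ico (s (i + 1)) ⌈N * s (i + 1)⌉₊, α.a l ^ d) *
    α.t (s (n + 1)) ^ d

variable (α) in
lemma tendsto_t : Tendsto α.t atTop (𝓝 0) := by
  refine (tendsto_add_atTop_iff_nat 1).1 ?_
  have h := α.hasSum_a.tendsto_sum_nat.const_sub 1
  rw [sub_self] at h
  refine h.congr fun n => ?_
  have := α.t_eq_sum_add (m := 1) le_rfl n
  rw [α.t_one] at this
  simp only [add_comm 1] at this
  linarith

/-- The natural cover by cylinders; its sum over words factorizes into `coverSum`. The filter `F` is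
left free so that the cover can be restricted to a favourable subsequence of levels. -/
lemma hausdorffMeasure_jarnikSet_le (hs_pos : ∀ n, 1 ≤ n → 1 ≤ s n) (hs : Tendsto s atTop atTop)
    {d : ℝ} (hd : 0 < d) {F : Filter ℕ} (hF : F ≤ atTop) :
    μH[d] (α.jarnikSet s N) ≤ liminf (fun n => ENNReal.ofReal (α.coverSum s N d n)) F := by
  have hw1 : ∀ n, ∀ w ∈ words s N n, ∀ i, 1 ≤ w i := fun n w hw i =>
    (hs_pos (i + 1) (by omega)).trans (Finset.mem_Ico.1 (Fintype.mem_piFinset.1 hw i)).1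
  have hprod : ∀ n, ∀ w ∈ words s N n, 0 ≤ ∏ i, α.a (w i) := fun n w hw =>
    Finset.prod_nonneg fun i _ => (α.a_pos _ (hw1 n w hw i)).le
  have htp : ∀ n, 0 < α.t (s (n + 1)) := fun n => α.t_pos (hs_pos _ (by omega))
  let T : ∀ n, words s N n → Set ℝ := fun n w =>
    {x | x ∈ α.jarnikSet s N ∧ ∀ i : Fin n, α.ell (i + 1) x = w.1 i}
  have hdiam : ∀ n (w : words s N n),
      Metric.ediam (T n w) ≤ ENNReal.ofReal ((∏ i, α.a (w.1 i)) * α.t (s (n + 1))) := by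
    intro n w
    refine Metric.ediam_le fun x hx y hy => ?_
    obtain ⟨hx1, hx2⟩ := jarnikSet_orbit hs_pos hx.1
    obtain ⟨hy1, hy2⟩ := jarnikSet_orbit hs_pos hy.1
    rw [edist_dist, Real.dist_eq]
    refine ENNReal.ofReal_le_ofReal ?_
    have h := hx1.abs_sub_eq hy1
      (fun k => (hs_pos _ (by omega)).trans (hx.1.2 (k + 1) (by omega)).1) n
      (fun k hk => (hx.2 ⟨k, hk⟩).trans (hy.2 ⟨k, hk⟩).symm)
    simp only [Function.iterate_zero, id] at h
    rw [h, Finset.prod_range fun i => α.a (α.ell (i + 1) x)]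
    simp only [hx.2]
    refine mul_le_mul_of_nonneg_left ?_ (hprod n _ w.2)
    have := hx2 n
    have := hy2 n
    simp only [Set.mem_Icc] at *
    rw [abs_le]
    constructor <;> linarith
  refine (Measure.hausdorffMeasure_le_liminf_sum d _ (l := F)
    (fun n => ENNReal.ofReal (α.t (s (n + 1)))) ?_ T ?_ ?_).trans ?_
  · have h := ENNReal.tendsto_ofReal
      (α.tendsto_t.comp ((tendsto_add_atTop_iff_nat 1).2 hs))
    rw [ENNReal.ofReal_zero] at h
    exact h.mono_left hF
  · refine Eventually.of_forall fun n w => (hdiam n w).trans (ENNReal.ofReal_le_ofReal ?_)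
    refine mul_le_of_le_one_left (htp n).le (Finset.prod_le_one ?_ ?_)
    · exact fun i _ => (α.a_pos _ (hw1 n _ w.2 i)).le
    · exact fun i _ => α.a_le_one (hw1 n _ w.2 i)
  · refine Eventually.of_forall fun n x hx => Set.mem_iUnion.2
      ⟨⟨fun i => α.ell (i + 1) x, Fintype.mem_piFinset.2 fun i => ?_⟩, hx, fun i => rfl⟩
    have := hx.2 (i + 1) (by omega)
    exact Finset.mem_Ico.2 ⟨this.1, Nat.lt_ceil.2 this.2⟩
  · refine liminf_le_liminf (Eventually.of_forall fun n => ?_)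
    calc ∑ w : words s N n, Metric.ediam (T n w) ^ d
        ≤ ∑ w : words s N n, ENNReal.ofReal (((∏ i, α.a (w.1 i)) * α.t (s (n + 1))) ^ d) := by
          refine Finset.sum_le_sum fun w _ => ?_
          rw [← ENNReal.ofReal_rpow_of_nonneg (mul_nonneg (hprod n _ w.2) (htp n).le) hd.le]
          exact ENNReal.rpow_le_rpow (hdiam n w) hd.le
      _ = ENNReal.ofReal (∑ w ∈ words s N n, ((∏ i, α.a (w i)) * α.t (s (n + 1))) ^ d) := by
          rw [ENNReal.ofReal_sum_of_nonneg fun w hw =>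
            Real.rpow_nonneg (mul_nonneg (hprod n w hw) (htp n).le) _]
          exact Finset.sum_coe_sort (words s N n) fun w =>
            ENNReal.ofReal (((∏ i, α.a (w i)) * α.t (s (n + 1))) ^ d)
      _ = _ := by
          congr 1
          rw [coverSum, Finset.prod_range fun i =>
            ∑ l ∈ Finset.Ico (s (i + 1)) ⌈N * s (i + 1)⌉₊, α.a l ^ d,
            Finset.prod_univ_sum, Finset.sum_mul]
          refine Finset.sum_congr rfl fun w hw => ?_
          rw [Real.mul_rpow (hprod n w hw) (htp n).le, Real.finsetProd_rpow]
          exact fun i _ => (α.a_pos _ (hw1 n w hw i)).le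

lemma exists_coverSum_le (hexp : α.IsExpansive θ) (hdec : α.IsEventuallyDecreasing)
    (hs_pos : ∀ n, 1 ≤ n → 1 ≤ s n) (hs : Tendsto s atTop atTop) (hN : 3 < N) {d : ℝ} (hd : 0 < d)
    {ε : ℝ} (hε : 0 < ε) (hεθ : ε ≤ θ) : ∃ K, 0 < K ∧ ∀ n, α.coverSum s N d n ≤
      K * Real.exp ((1 + ε - d * (1 + θ - ε)) * logSum s n
        - d * (θ - ε) * Real.log (s (n + 1))) := by
  obtain ⟨A, hA, ha⟩ := exists_a_le hdec hexp hε hεθ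
  obtain ⟨B, hB, hb⟩ := hexp.exists_t_le hε hεθ
  set p := 1 - d * (1 + θ - ε) with hp
  have hN0 : 0 < N := by linarith
  have hsum : ∀ n, ∑ l ∈ Finset.Ico (s (n + 1)) ⌈N * s (n + 1)⌉₊, α.a l ^ d ≤
      N * A ^ d * (s (n + 1) : ℝ) ^ p := by
    intro n
    have hs0 := digit_cast_pos hs_pos n
    have hs1 := hs_pos (n + 1) (by omega)
    have h1 : ∀ l ∈ Finset.Ico (s (n + 1)) ⌈N * s (n + 1)⌉₊,
        α.a l ^ d ≤ A ^ d * (s (n + 1) : ℝ) ^ (p - 1) := by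
      intro l hl
      have hl := (Finset.mem_Ico.1 hl).1
      have hal := α.a_pos l (hs1.trans hl)
      rw [show p - 1 = -(1 + θ - ε) * d by rw [hp]; ring, Real.rpow_mul hs0.le,
        ← Real.mul_rpow hA.le (by positivity)]
      refine Real.rpow_le_rpow hal.le ((ha l (hs1.trans hl)).trans ?_) hd.le
      refine mul_le_mul_of_nonneg_left ?_ hA.le
      exact Real.rpow_le_rpow_of_nonpos hs0 (by exact_mod_cast hl) (by linarith)
    refine (Finset.sum_le_sum h1).trans ?_
    rw [Finset.sum_const, Nat.card_Ico, nsmul_eq_mul]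
    have hcard : ((⌈N * s (n + 1)⌉₊ - s (n + 1) : ℕ) : ℝ) ≤ N * s (n + 1) := by
      have h := Nat.ceil_lt_add_one (a := N * s (n + 1)) (by positivity)
      have h2 : s (n + 1) ≤ ⌈N * (s (n + 1) : ℝ)⌉₊ := by
        refine Nat.le_of_lt (Nat.lt_ceil.2 ?_)
        nlinarith
      rw [Nat.cast_sub h2]
      have : (1 : ℝ) ≤ s (n + 1) := by exact_mod_cast hs1
      linarith
    calc _ ≤ N * s (n + 1) * (A ^ d * (s (n + 1) : ℝ) ^ (p - 1)) := by gcongr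
      _ = N * A ^ d * (s (n + 1) * (s (n + 1) : ℝ) ^ (p - 1)) := by ring
      _ = _ := by rw [Real.rpow_sub_one hs0.ne', mul_div_cancel₀ _ hs0.ne']
  have hpos : ∀ n, 0 < N * A ^ d * (s (n + 1) : ℝ) ^ p := fun n => by
    have := digit_cast_pos hs_pos n
    positivity
  -- The extra `ε` in the exponent swallows the factor `N * A ^ d` of each digit.
  obtain ⟨C, hC, hc⟩ := exists_prod_le_of_eventually_le hpos
    (v := fun n => (s (n + 1) : ℝ) ^ (p + ε))
    (fun n => Real.rpow_pos_of_pos (digit_cast_pos hs_pos n) _) <| by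
      filter_upwards [eventually_const_le_digit_rpow hs (N * A ^ d) hε] with n hn
      have := digit_cast_pos hs_pos n
      rw [Real.rpow_add this, mul_comm]
      gcongr
  refine ⟨C * B ^ d, by positivity, fun n => ?_⟩
  have hs0 := digit_cast_pos hs_pos n
  have hs1 := hs_pos (n + 1) (by omega)
  have h1 : ∏ i ∈ Finset.range n, ∑ l ∈ Finset.Ico (s (i + 1)) ⌈N * s (i + 1)⌉₊, α.a l ^ d ≤
      C * Real.exp ((p + ε) * logSum s n) := by
    rw [← prod_rpow_eq_exp hs_pos]
    refine le_trans (Finset.prod_le_prod (fun i _ => ?_) fun i _ => hsum i) (hc n)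
    refine Finset.sum_nonneg fun l hl => Real.rpow_nonneg (α.a_pos l ?_).le _
    exact (hs_pos (i + 1) (by omega)).trans (Finset.mem_Ico.1 hl).1
  have h2 : α.t (s (n + 1)) ^ d ≤ B ^ d * Real.exp (-(d * (θ - ε) * Real.log (s (n + 1)))) := by
    have : Real.exp (-(d * (θ - ε) * Real.log (s (n + 1)))) =
        ((s (n + 1) : ℝ) ^ (-(θ - ε))) ^ d := by
      rw [← Real.rpow_mul hs0.le, Real.rpow_def_of_pos hs0]
      ring_nf
    rw [this, ← Real.mul_rpow hB.le (by positivity)]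
    exact Real.rpow_le_rpow (α.t_pos hs1).le (hb _ hs1) hd.le
  calc α.coverSum s N d n ≤ C * Real.exp ((p + ε) * logSum s n) *
        (B ^ d * Real.exp (-(d * (θ - ε) * Real.log (s (n + 1))))) :=
        mul_le_mul h1 h2 (Real.rpow_nonneg (α.t_pos hs1).le _) (by positivity)
    _ = C * B ^ d * (Real.exp ((p + ε) * logSum s n) *
        Real.exp (-(d * (θ - ε) * Real.log (s (n + 1))))) := by ring
    _ = _ := by rw [← Real.exp_add, hp]; ring_nf

theorem dimH_jarnikSet_le (hθ : 0 < θ) (hexp : α.IsExpansive θ) (hdec : α.IsEventuallyDecreasing)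
    (hs_pos : ∀ n, 1 ≤ n → 1 ≤ s n) (hs : Tendsto s atTop atTop) (hN : 3 < N) :
    dimH (α.jarnikSet s N) ≤ ENNReal.ofReal (jarnikExponent s θ) := by
  refine le_of_forall_gt fun D hD => ?_
  obtain ⟨D', hD1, hD2⟩ := ENNReal.lt_iff_exists_nnreal_btwn.1 hD
  refine lt_of_le_of_lt (dimH_le_of_hausdorffMeasure_ne_top ?_) hD2
  have hσ := jarnikExponent_nonneg hs_pos hθ
  have hlt : jarnikExponent s θ < D' := by
    rwa [ENNReal.ofReal_lt_coe_iff hσ] at hD1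
  set d : ℝ := (D' : ℝ)
  have hd : 0 < d := hσ.trans_lt hlt
  obtain ⟨b, hb1, hb2⟩ := exists_between hlt
  -- The `ε`-errors in the exponent total at most `ε (1 + d) (P + Q)`, which must stay below the
  -- gain `(d - b) ((1 + θ) P + θ Q)`.
  set ε := min θ ((d - b) * θ / (2 * (1 + d))) with hε_def
  have hδ : 0 < d - b := by linarith
  have hε : 0 < ε := by positivity
  have hε2 : ε * (2 * (1 + d)) ≤ (d - b) * θ := by
    rw [← le_div_iff₀ (by positivity)]
    exact min_le_right _ _
  obtain ⟨K, hK, hsum⟩ := exists_coverSum_le hexp hdec hs_pos hs hN hd hε (min_le_left _ _)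
  have hfreq := frequently_of_jarnikExponent_lt hs_pos hθ hs hb1
  set F := atTop ⊓ 𝓟 {n | logSum s n < b * ((1 + θ) * logSum s n + θ * Real.log (s (n + 1) : ℝ))}
  have : F.NeBot := frequently_iff_neBot.1 hfreq
  refine ne_top_of_le_ne_top ?_ (hausdorffMeasure_jarnikSet_le hs_pos hs hd inf_le_left (F := F))
  have hbound : ∀ᶠ n in F, ENNReal.ofReal (α.coverSum s N d n) ≤ ENNReal.ofReal K := by
    filter_upwards [mem_inf_of_right (mem_principal_self _)] with n hn
    refine ENNReal.ofReal_le_ofReal ((hsum n).trans ?_)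
    refine mul_le_of_le_one_right hK.le (Real.exp_le_one_iff.2 ?_)
    have hP := logSum_nonneg hs_pos n
    have hQ := log_digit_nonneg hs_pos n
    set P := logSum s n
    set Q := Real.log (s (n + 1) : ℝ)
    have hn : P < b * ((1 + θ) * P + θ * Q) := hn
    have e1 := mul_le_mul_of_nonneg_right hε2 hP
    have e2 := mul_le_mul_of_nonneg_right hε2 hQ
    have e3 := mul_nonneg hε.le hP
    have e4 := mul_nonneg hε.le hQ
    have e5 := mul_nonneg hd.le e3
    have e6 := mul_nonneg hd.le e4
    have e7 := mul_nonneg hδ.le hP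
    nlinarith
  refine ne_top_of_le_ne_top ENNReal.ofReal_ne_top (liminf_le_of_frequently_le hbound.frequently)

end LurothPartition

/-! ### Mixed radix expansions -/

/-- The numerator of the lower approximation of `y` with denominator `s_1 ⋯ s_n`. -/
def radixFloor (s : ℕ → ℕ) (n : ℕ) (y : ℝ) : ℕ := ⌊(∏ i ∈ Finset.range n, (s (i + 1) : ℝ)) * y⌋₊

lemma radixFloor_succ_div {s : ℕ → ℕ} (hs_pos : ∀ n, 1 ≤ n → 1 ≤ s n) (n : ℕ) (y : ℝ) :
    radixFloor s (n + 1) y / s (n + 1) = radixFloor s n y := by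
  rw [radixFloor, ← Nat.floor_div_natCast, Finset.prod_range_succ, radixFloor]
  have := (digit_cast_pos hs_pos n).ne'
  congr 1
  field_simp

lemma prod_digit_eq_exp {s : ℕ → ℕ} (hs_pos : ∀ n, 1 ≤ n → 1 ≤ s n) (n : ℕ) :
    ∏ i ∈ Finset.range n, (s (i + 1) : ℝ) = Real.exp (logSum s n) := by
  simpa using prod_rpow_eq_exp hs_pos 1 n

/-- The denominators tend to infinity, so the floors eventually differ. The first such level is not
`0`, since both floors there vanish on `[0,1)`. -/
lemma exists_radixFloor_ne {s : ℕ → ℕ} (hs_pos : ∀ n, 1 ≤ n → 1 ≤ s n)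
    (hs : Tendsto s atTop atTop) {y y' : ℝ} (h0 : 0 ≤ y) (h : y < y')
    (h1 : y' < 1) : ∃ n, (∀ k ≤ n, radixFloor s k y = radixFloor s k y') ∧
      radixFloor s (n + 1) y < radixFloor s (n + 1) y' := by
  have hex : ∃ n, radixFloor s n y ≠ radixFloor s n y' := by
    have hlim : Tendsto (fun n => Real.exp (logSum s n) * (y' - y)) atTop atTop :=
      (Real.tendsto_exp_atTop.comp (tendsto_logSum hs_pos hs)).atTop_mul_const (by linarith)
    obtain ⟨n, hn⟩ := (hlim.eventually_ge_atTop 1).exists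
    refine ⟨n, fun heq => ?_⟩
    have hM := Real.exp_pos (logSum s n)
    rw [radixFloor, radixFloor, prod_digit_eq_exp hs_pos] at heq
    have e1 := Nat.lt_floor_add_one (Real.exp (logSum s n) * y')
    have e2 := Nat.floor_le (a := Real.exp (logSum s n) * y) (by positivity)
    rw [← heq] at e1
    linarith
  classical
  obtain ⟨n, hn⟩ : ∃ n, Nat.find hex = n + 1 := by
    refine Nat.exists_eq_succ_of_ne_zero fun h => ?_
    have := Nat.find_spec hex
    rw [h] at this
    apply this
    have e1 : ⌊y⌋₊ = 0 := Nat.floor_eq_zero.2 (by linarith)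
    have e2 : ⌊y'⌋₊ = 0 := Nat.floor_eq_zero.2 h1
    simp [radixFloor, e1, e2]
  refine ⟨n, fun k hk => ?_, lt_of_le_of_ne ?_ ?_⟩
  · exact not_not.1 (Nat.find_min hex (by omega))
  · refine Nat.floor_le_floor (mul_le_mul_of_nonneg_left h.le ?_)
    exact Finset.prod_nonneg fun i _ => Nat.cast_nonneg _
  · exact hn ▸ Nat.find_spec hex

/-- The digits `s_n < l ≤ 2 s_n` that code the mixed radix expansion of `y`. -/
def radixDigit (s : ℕ → ℕ) (y : ℝ) (n : ℕ) : ℕ :=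
  s (n + 1) + 1 + radixFloor s (n + 1) y % s (n + 1)

lemma radixDigit_mem {s : ℕ → ℕ} (hs_pos : ∀ n, 1 ≤ n → 1 ≤ s n) (y : ℝ) (n : ℕ) :
    s (n + 1) + 1 ≤ radixDigit s y n ∧ radixDigit s y n ≤ 2 * s (n + 1) := by
  have := Nat.mod_lt (radixFloor s (n + 1) y) (hs_pos (n + 1) (by omega))
  rw [radixDigit]
  omega

namespace LurothPartition

variable {α : LurothPartition} {s : ℕ → ℕ} {N θ : ℝ}

/-! ### Lower bound -/

/-- Since `x (n + 1) ≤ t_2 = 1 - a_1`, the point `x n` stays away from the left end of its atom.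
Hence even points of adjacent atoms are separated, by at least the share `a_1` of the total length
of the atoms from `l n` up to `l' n - 1`. -/
lemma IsOrbit.le_abs_sub {l l' : ℕ → ℕ} {x y : ℕ → ℝ} (hx : α.IsOrbit l x) (hy : α.IsOrbit l' y)
    (hxb : ∀ k, x k ≤ α.t 2) (hyb : ∀ k, 0 < y k) (hl : ∀ k, 1 ≤ l k) {n : ℕ}
    (h : ∀ k < n, l k = l' k) (hlt : l n < l' n) :
    (∏ i ∈ Finset.range n, α.a (l i)) *
      (α.a 1 * ∑ i ∈ Finset.range (l' n - l n), α.a (l n + i)) ≤ |x 0 - y 0| := by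
  rw [hx.abs_sub_eq hy hl n h]
  refine mul_le_mul_of_nonneg_left ?_ (Finset.prod_nonneg fun i _ => (α.a_pos _ (hl i)).le)
  refine le_trans ?_ (le_abs_self _)
  have h1 := α.t_eq_sum_add (hl n) (l' n - l n)
  rw [Nat.add_sub_cancel' hlt.le] at h1
  have h2 : α.a (l n) ≤ ∑ i ∈ Finset.range (l' n - l n), α.a (l n + i) := by
    have := Finset.single_le_sum (f := fun i => α.a (l n + i)) (s := Finset.range (l' n - l n))
      (fun i _ => (α.a_pos _ (le_add_right (hl n))).le) (Finset.mem_range.2 (by omega : 0 < _))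
    simpa using this
  set S := ∑ i ∈ Finset.range (l' n - l n), α.a (l n + i)
  have h3 := α.t_eq_add (n := 1) le_rfl
  rw [α.t_one] at h3
  norm_num at h3
  have h4 := mul_pos (α.a_pos _ ((hl n).trans hlt.le)) (hyb (n + 1))
  have h5 := mul_le_mul_of_nonneg_left (hxb (n + 1)) (α.a_pos _ (hl n)).le
  have h6 := mul_le_mul_of_nonneg_right h2 (α.t_pos (n := 2) (by norm_num)).le
  have h7 : α.a 1 * S = S - S * α.t 2 := by
    rw [show α.a 1 = 1 - α.t 2 by linarith]; ring
  rw [hx n, hy n, h7]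
  linarith

/-- Let `n + 1` be the first level where the floors differ, with digit difference `q`. Up to
constants and `ε`-losses, `|y - y'|` is at most `(q / s_{n+1}) exp (-P)`, while the coded points are
at least `(q / s_{n+1}) exp (-((1+θ) P + θ Q))` apart. The exponentials compare because `d < σ`, and
`q / s_{n+1} ≤ (q / s_{n+1})^d` because `d ≤ 1`. Keeping `q` handles the scales between consecutive
levels. -/
lemma exists_abs_sub_le_of_lt_jarnikExponent (hθ : 0 < θ) (hexp : α.IsExpansive θ)
    (hdec : α.IsEventuallyDecreasing) (hs_pos : ∀ n, 1 ≤ n → 1 ≤ s n)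
    (hs : Tendsto s atTop atTop) {d : ℝ} (hd : 0 < d) (hdσ : d < jarnikExponent s θ) :
    ∃ C, 0 < C ∧ ∀ (x x' : ℕ → ℝ) (y y' : ℝ), 0 ≤ y → y < y' → y' < 1 →
      α.IsOrbit (radixDigit s y) x → α.IsOrbit (radixDigit s y') x' →
      (∀ k, 0 < x k ∧ x k ≤ α.t 2) → (∀ k, 0 < x' k ∧ x' k ≤ α.t 2) →
      |y - y'| ≤ C * |x 0 - x' 0| ^ d := by
  have hd1 : d ≤ 1 := hdσ.le.trans (jarnikExponent_le_one hs_pos hθ)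
  obtain ⟨b, hb1, hb2⟩ := exists_between hdσ
  have hδ : 0 < b - d := by linarith
  -- The coefficient of `P` loses `2ε`, once for the length bound and once for constants; that of
  -- `Q` loses only `ε`. The gap `b - d` pays for both.
  set ε := (b - d) * θ / (2 * d) with hε_def
  have hε : 0 < ε := by positivity
  have hε2 : 2 * d * ε = (b - d) * θ := by rw [hε_def]; field_simp
  obtain ⟨c, hc, ha⟩ := exists_le_a hθ hdec hexp hε
  set p := 1 + θ + ε with hp
  -- the lengths of all atoms that occur
  have hatom : ∀ n l, 1 ≤ l → l ≤ 2 * s (n + 1) →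
      c * 2 ^ (-p) * (s (n + 1) : ℝ) ^ (-p) ≤ α.a l := by
    intro n l h1 h2
    refine le_trans ?_ (ha l h1)
    rw [mul_assoc, ← Real.mul_rpow two_pos.le (Nat.cast_nonneg _)]
    refine mul_le_mul_of_nonneg_left ?_ hc.le
    exact Real.rpow_le_rpow_of_nonpos (by exact_mod_cast h1) (by exact_mod_cast h2) (by linarith)
  have hvpos : ∀ n, 0 < c * 2 ^ (-p) * (s (n + 1) : ℝ) ^ (-p) := fun n => by
    have := digit_cast_pos hs_pos n
    positivity
  obtain ⟨C, hC, hprod⟩ := exists_prod_le_of_eventually_le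
    (u := fun n => (s (n + 1) : ℝ) ^ (-(p + ε)))
    (fun n => Real.rpow_pos_of_pos (digit_cast_pos hs_pos n) _) hvpos <| by
      filter_upwards [eventually_const_le_digit_rpow hs (c * 2 ^ (-p))⁻¹ hε] with n hn
      have := digit_cast_pos hs_pos n
      rw [neg_add, Real.rpow_add this, mul_comm, Real.rpow_neg this.le ε]
      gcongr
      exact inv_le_of_inv_le₀ (by positivity) hn
  obtain ⟨B, hB, hexpo⟩ : ∃ B, 0 < B ∧ ∀ n, Real.exp (-logSum s n) ≤ B *
      Real.exp (-(d * ((p + ε) * logSum s n + (p - 1) * Real.log (s (n + 1))))) := by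
    -- The index is shifted because `exists_forall_ge_one` starts at `1`.
    suffices h : ∃ B, 0 < B ∧ ∀ n, 1 ≤ n → Real.exp (-logSum s (n - 1)) ≤ B *
      Real.exp (-(d * ((p + ε) * logSum s (n - 1) + (p - 1) * Real.log (s (n - 1 + 1))))) by
      obtain ⟨B, hB, h⟩ := h
      exact ⟨B, hB, fun n => h (n + 1) (by omega)⟩
    refine exists_forall_ge_one (P := fun n B => Real.exp (-logSum s (n - 1)) ≤ B *
      Real.exp (-(d * ((p + ε) * logSum s (n - 1) + (p - 1) * Real.log (s (n - 1 + 1))))))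
      (fun n C D _ hCD h => h.trans (by gcongr)) (fun n _ => ?_) ⟨1, ?_⟩
    · exact ⟨_, (div_mul_cancel₀ _ (Real.exp_pos _).ne').ge⟩
    · have hev := eventually_of_lt_jarnikExponent hs_pos hθ hs hb2
      filter_upwards [(tendsto_sub_atTop_nat 1).eventually hev] with n hn
      rw [one_mul, Real.exp_le_exp, neg_le_neg_iff]
      have hP := logSum_nonneg hs_pos (n - 1)
      have hQ := log_digit_nonneg hs_pos (n - 1)
      set P := logSum s (n - 1)
      set Q := Real.log (s (n - 1 + 1) : ℝ)
      refine le_trans ?_ hn.le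
      have e1 : 2 * d * ε * P = (b - d) * θ * P := by rw [hε2]
      have e2 : 2 * d * ε * Q = (b - d) * θ * Q := by rw [hε2]
      have e3 := mul_nonneg hδ.le hP
      have e4 := mul_nonneg (mul_nonneg hd.le hε.le) hQ
      rw [hp]
      nlinarith
  set κ := C⁻¹ * (α.a 1 * (c * 2 ^ (-p))) with hκ_def
  have ha1 := α.a_pos 1 le_rfl
  have hκ : 0 < κ := by positivity
  refine ⟨2 * B / κ ^ d, by positivity, fun x x' y y' hy hyy hy' hx hx' hxb hxb' => ?_⟩
  obtain ⟨n, heq, hlt⟩ := exists_radixFloor_ne hs_pos hs hy hyy hy'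
  have hs1 := hs_pos (n + 1) (by omega)
  have hs0 := digit_cast_pos hs_pos n
  have hdig : ∀ k < n, radixDigit s y k = radixDigit s y' k := fun k hk => by
    rw [radixDigit, radixDigit, heq (k + 1) (by omega)]
  have hF := Nat.div_add_mod (radixFloor s (n + 1) y) (s (n + 1))
  have hF' := Nat.div_add_mod (radixFloor s (n + 1) y') (s (n + 1))
  rw [radixFloor_succ_div hs_pos] at hF hF'
  rw [← heq n le_rfl] at hF'
  -- Both floors have the same quotient by `s (n + 1)`, so they differ by their remainders.
  have hdiff : radixFloor s (n + 1) y' - radixFloor s (n + 1) y =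
      radixDigit s y' n - radixDigit s y n := by
    rw [radixDigit, radixDigit]; omega
  have hdlt : radixDigit s y n < radixDigit s y' n := by omega
  obtain ⟨hm1, hm2⟩ := radixDigit_mem hs_pos y n
  obtain ⟨hm1', hm2'⟩ := radixDigit_mem hs_pos y' n
  have hsep := hx.le_abs_sub hx' (fun k => (hxb k).2) (fun k => (hxb' k).1)
    (fun k => le_trans (by omega) (radixDigit_mem hs_pos y k).1) hdig hdlt
  set q := radixDigit s y' n - radixDigit s y n with hq
  have hq1 : 1 ≤ q := by omega
  have hqs : q ≤ s (n + 1) := by omega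
  have hqR : (1 : ℝ) ≤ q := by exact_mod_cast hq1
  have hqs' : (q : ℝ) / s (n + 1) ≤ 1 := (div_le_one hs0).2 (by exact_mod_cast hqs)
  have hqs0 : 0 < (q : ℝ) / s (n + 1) := by positivity
  -- upper bound for the distance of `y` and `y'`
  have hup : |y - y'| ≤ 2 * (q / s (n + 1)) * Real.exp (-logSum s n) := by
    have hM : (∏ i ∈ Finset.range (n + 1), (s (i + 1) : ℝ)) = Real.exp (logSum s n) * s (n + 1) := by
      rw [Finset.prod_range_succ, prod_digit_eq_exp hs_pos]
    have hE := Real.exp_pos (logSum s n)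
    have hqe : (radixFloor s (n + 1) y' : ℝ) = radixFloor s (n + 1) y + q := by
      exact_mod_cast (by omega : radixFloor s (n + 1) y' = radixFloor s (n + 1) y + q)
    -- The scaled distance is below `q + 1 ≤ 2 * q`, as `q ≥ 1`.
    have e1 := Nat.lt_floor_add_one ((∏ i ∈ Finset.range (n + 1), (s (i + 1) : ℝ)) * y')
    have e2 := Nat.floor_le (a := (∏ i ∈ Finset.range (n + 1), (s (i + 1) : ℝ)) * y)
      (by rw [hM]; positivity)
    rw [radixFloor, radixFloor] at hqe
    rw [hqe] at e1
    rw [hM] at e1 e2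
    rw [abs_sub_comm, abs_of_pos (by linarith), Real.exp_neg, ← div_eq_mul_inv, le_div_iff₀ hE,
      ← mul_div_assoc, le_div_iff₀ hs0]
    linarith
  -- lower bound for the distance of the coded points
  have hlow : κ * (q / s (n + 1)) *
      Real.exp (-((p + ε) * logSum s n + (p - 1) * Real.log (s (n + 1)))) ≤ |x 0 - x' 0| := by
    refine le_trans ?_ hsep
    have e1 : C⁻¹ * Real.exp (-(p + ε) * logSum s n) ≤
        ∏ i ∈ Finset.range n, α.a (radixDigit s y i) := by
      rw [← prod_rpow_eq_exp hs_pos, inv_mul_le_iff₀ hC]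
      refine (hprod n).trans (mul_le_mul_of_nonneg_left ?_ hC.le)
      refine Finset.prod_le_prod (fun i _ => (hvpos i).le) fun i _ => hatom i _ ?_ ?_
      · exact le_trans (by omega) (radixDigit_mem hs_pos y i).1
      · exact (radixDigit_mem hs_pos y i).2
    have e2 : q * (c * 2 ^ (-p) * (s (n + 1) : ℝ) ^ (-p)) ≤
        ∑ i ∈ Finset.range q, α.a (radixDigit s y n + i) := by
      have := Finset.sum_le_sum (s := Finset.range q) (f := fun _ =>
        c * 2 ^ (-p) * (s (n + 1) : ℝ) ^ (-p)) (g := fun i => α.a (radixDigit s y n + i))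
        fun i hi => hatom n _ (by omega) (by have := Finset.mem_range.1 hi; omega)
      simpa using this
    have e3 : Real.exp (-((p + ε) * logSum s n + (p - 1) * Real.log (s (n + 1)))) =
        Real.exp (-(p + ε) * logSum s n) * (s (n + 1) * (s (n + 1) : ℝ) ^ (-p)) := by
      have : (s (n + 1) : ℝ) * (s (n + 1) : ℝ) ^ (-p) = (s (n + 1) : ℝ) ^ (1 - p) := by
        rw [sub_eq_add_neg, Real.rpow_add hs0, Real.rpow_one]
      rw [this, Real.rpow_def_of_pos hs0, ← Real.exp_add]
      ring_nf
    calc _ = C⁻¹ * Real.exp (-(p + ε) * logSum s n) *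
          (α.a 1 * (q * (c * 2 ^ (-p) * (s (n + 1) : ℝ) ^ (-p)))) := by
          rw [e3, hκ_def]; field_simp
      _ ≤ _ := by gcongr; exact (by positivity : (0 : ℝ) ≤ _).trans e1
  have hlow' := Real.rpow_le_rpow (by positivity) hlow hd.le
  rw [Real.mul_rpow (by positivity) (Real.exp_pos _).le, Real.mul_rpow hκ.le hqs0.le,
    ← Real.exp_mul, neg_mul, mul_comm _ d] at hlow'
  have hpow : (q : ℝ) / s (n + 1) ≤ (q / s (n + 1)) ^ d := by
    simpa using Real.rpow_le_rpow_of_exponent_ge hqs0 hqs' hd1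
  have hκd : 0 < κ ^ d := by positivity
  rw [div_mul_eq_mul_div, le_div_iff₀ hκd]
  set E := Real.exp (-(d * ((p + ε) * logSum s n + (p - 1) * Real.log (s (n + 1)))))
  calc |y - y'| * κ ^ d ≤ 2 * (q / s (n + 1)) ^ d * (B * E) * κ ^ d := by
        refine mul_le_mul_of_nonneg_right (hup.trans ?_) hκd.le
        have := hexpo n
        gcongr
    _ = 2 * B * (κ ^ d * (q / s (n + 1)) ^ d * E) := by ring
    _ ≤ _ := by gcongr

theorem le_dimH_jarnikSet (hθ : 0 < θ) (hexp : α.IsExpansive θ) (hdec : α.IsEventuallyDecreasing)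
    (hs_pos : ∀ n, 1 ≤ n → 1 ≤ s n) (hs : Tendsto s atTop atTop) (hN : 3 < N) :
    ENNReal.ofReal (jarnikExponent s θ) ≤ dimH (α.jarnikSet s N) := by
  refine le_of_forall_lt fun D hD => ?_
  obtain ⟨r, hr1, hr2⟩ := ENNReal.lt_iff_exists_nnreal_btwn.1 hD
  refine hr1.trans_le ?_
  rcases eq_or_ne r 0 with rfl | hr0
  · simp
  have hr : 0 < r := pos_iff_ne_zero.2 hr0
  have hrσ : (r : ℝ) < jarnikExponent s θ := (ENNReal.lt_ofReal_iff_toReal_lt (by simp)).1 hr2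
  obtain ⟨C, hC, hbd⟩ := exists_abs_sub_le_of_lt_jarnikExponent hθ hexp hdec hs_pos hs
    (NNReal.coe_pos.2 hr) hrσ
  -- The offset `+ 1` in `radixDigit` secures this even where `s` takes the value `1`.
  have hdig2 : ∀ y k, 2 ≤ radixDigit s y k := fun y k => by
    have := (radixDigit_mem hs_pos y k).1
    have := hs_pos (k + 1) (by omega)
    omega
  choose x hx hxb using fun y => α.exists_isOrbit (hdig2 y)
  set g : ℝ → ℝ := fun y => x y 0
  have hg : ∀ y, g y ∈ α.jarnikSet s N := fun y => by
    obtain ⟨h1, h2⟩ := (hx y).iterate_eq (hdig2 y) (hxb y)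
    refine ⟨h1, fun n hn => ?_⟩
    obtain ⟨m, rfl⟩ := Nat.exists_eq_add_of_le' hn
    obtain ⟨h3, h4⟩ := radixDigit_mem hs_pos y m
    have hs0 := digit_cast_pos hs_pos m
    rw [h2]
    refine ⟨by omega, lt_of_le_of_lt (b := (2 * s (m + 1) : ℝ)) (by exact_mod_cast h4) ?_⟩
    nlinarith
  have hdist : ∀ y ∈ Set.Ico (0 : ℝ) 1, ∀ y' ∈ Set.Ico (0 : ℝ) 1,
      |y - y'| ≤ C * |g y - g y'| ^ (r : ℝ) := by
    intro y hy y' hy'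
    rcases lt_trichotomy y y' with h | rfl | h
    · exact hbd _ _ _ _ hy.1 h hy'.2 (hx y) (hx y') (hxb y) (hxb y')
    · rw [sub_self, abs_zero]; positivity
    · rw [abs_sub_comm, abs_sub_comm (g y)]
      exact hbd _ _ _ _ hy'.1 h hy.2 (hx y') (hx y) (hxb y') (hxb y)
  have hinj : Set.InjOn g (Set.Ico 0 1) := fun y hy y' hy' h => by
    have := hdist y hy y' hy'
    rw [h, sub_self, abs_zero, Real.zero_rpow (NNReal.coe_ne_zero.2 hr0), mul_zero] at this
    exact sub_eq_zero.1 (abs_nonpos_iff.1 this)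
  have hleft := hinj.leftInvOn_invFunOn
  have hHolder : HolderOnWith C.toNNReal r (Function.invFunOn g (Set.Ico 0 1))
      (g '' Set.Ico 0 1) := by
    rintro _ ⟨y, hy, rfl⟩ _ ⟨y', hy', rfl⟩
    rw [hleft hy, hleft hy', edist_dist, edist_dist, Real.dist_eq, Real.dist_eq,
      ENNReal.ofReal_rpow_of_nonneg (abs_nonneg _) r.coe_nonneg]
    change _ ≤ ENNReal.ofReal C * _
    rw [← ENNReal.ofReal_mul hC.le]
    exact ENNReal.ofReal_le_ofReal (hdist y hy y' hy')
  -- The decoding map sends the coded set onto `[0,1)`, of dimension `1`, so `1 ≤ dimH / r`.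
  have hdim := hHolder.dimH_image_le hr
  rw [hleft.image_image, Real.dimH_of_nonempty_interior (by simp), Module.finrank_self,
    Nat.cast_one, ENNReal.le_div_iff_mul_le (by simp [hr0]) (by simp), one_mul] at hdim
  refine hdim.trans (dimH_mono ?_)
  rintro _ ⟨y, -, rfl⟩
  exact hg y

end LurothPartition

end

theorem theorem1p4 (α : LurothPartition) (θ : ℝ) (hθ : 0 < θ)
    (hexp : α.IsExpansive θ) (hdec : α.IsEventuallyDecreasing)
    (s : ℕ → ℕ) (hs_pos : ∀ n, 1 ≤ n → 1 ≤ s n) (hs : Tendsto s atTop atTop)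
    (N : ℝ) (hN : 3 < N) :
    dimH (α.jarnikSet s N) = ENNReal.ofReal (jarnikExponent s θ) :=
  le_antisymm (LurothPartition.dimH_jarnikSet_le hθ hexp hdec hs_pos hs hN)
    (LurothPartition.le_dimH_jarnikSet hθ hexp hdec hs_pos hs hN)
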